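/- Let $\mathcal H$ and $\mathcal K$ be finite-dimensional Hilbert spaces, let $\rho$ be a density operator on $\mathcal H$ (positive semi-definite with $\operatorname{Tr}\rho=1$), let $\sigma$ be a non-zero positive semi-definite operator on $\mathcal H$, and let $\mathcal N$ be a quantum channel (a linear, completely positive, trace-preserving map) taking operators on $\mathcal H$ to operators on $\mathcal K$. Let $U:\mathcal H\to\mathcal K\otimes\mathcal H_E$, with $\mathcal H_E$ finite-dimensional, be an isometric extension of $\mathcal N$, i.e. $U^\dagger U=I$ and $\mathcal N(X)=\operatorname{Tr}_E\{UXU^\dagger\}$ for all $X$. Powers of a positive semi-definite operator are evaluated on its support (the span of the eigenvectors with non-zero eigenvalue): $A^s=\sum_{i:a_i\neq0}a_i^s|i\rangle\langle i|$; and $\|A\|_2=[\operatorname{Tr}\{|A|^2\}]^{1/2}$ with $|A|=\sqrt{A^\dagger A}$. For $\alpha\in[0,1)\cup(1,2]$ define $$\Delta'_\alpha(\rho,\sigma,\mathcal N)=\frac{2}{\alpha-1}\max_{V_\sigma,V_{\mathcal N(\sigma)}}\log\left\|\left([\mathcal N(\rho)]^{(1-\alpha)/2}\,V_{\mathcal N(\sigma)}\,[\mathcal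 N(\sigma)]^{(\alpha-1)/2}\otimes I_E\right)U\,\sigma^{(1-\alpha)/2}\,V_\sigma\,\rho^{\alpha/2}\right\|_2,$$ where the maximum is over all unitaries $V_\sigma$ and $V_{\mathcal N(\sigma)}$ commuting with $\sigma$ and $\mathcal N(\sigma)$, respectively, and values are taken in $[-\infty,\infty]$ with $\log 0=-\infty$. Then $\Delta'_\alpha(\rho,\sigma,\mathcal N)$ is monotone non-decreasing in $\alpha$ on $[0,1)$ and on $(1,2]$. If moreover $\operatorname{supp}(\rho)\subseteq\operatorname{supp}(\sigma)$, then it is monotone non-decreasing on $[0,1)\cup(1,2]$, that is, $$\Delta'_\alpha(\rho,\sigma,\mathcal N)\le\Delta'_\gamma(\rho,\sigma,\mathcal N)\qquad\text{for all }0\le\alpha\le\gamma\le2,\ \alpha\ne1,\ \gamma\ne1.$$ -/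

import Mathlib

noncomputable section

namespace SwiveledRenyi

open scoped Kronecker ComplexOrder

/-! Operators on the finite-dimensional Hilbert spaces `ℂ^H`, `ℂ^K`, `ℂ^E` are complex matrices;
the tensor product `ℂ^K ⊗ ℂ^E` is `ℂ^(K × E)`. -/

section Channel

open scoped MatrixOrder Matrix.Norms.L2Operator

/-- A quantum channel: a linear, completely positive, trace-preserving map taking operators on
`ℂ^H` to operators on `ℂ^K`. -/
structure QuantumChannel (H K : Type*) [Fintype H] [DecidableEq H] [Fintype K] [DecidableEq K]
    extends CompletelyPositiveMap (Matrix H H ℂ) (Matrix K K ℂ) where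
  trace_preserving : ∀ X : Matrix H H ℂ, (toFun X).trace = X.trace

end Channel

/-- The action of a quantum channel on an operator. -/
def QuantumChannel.apply {H K : Type*} [Fintype H] [DecidableEq H] [Fintype K] [DecidableEq K]
    (N : QuantumChannel H K) (X : Matrix H H ℂ) : Matrix K K ℂ :=
  N.toFun X

/-- The partial trace over the second tensor factor `E`. -/
def partialTrace {K E : Type*} [Fintype E] (X : Matrix (K × E) (K × E) ℂ) : Matrix K K ℂ :=
  Matrix.of fun k l => ∑ e, X (k, e) (l, e)

/-- `U : ℂ^H → ℂ^K ⊗ ℂ^E` is an isometric extension (Stinespring isometry) of the channel `N`. -/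
structure IsIsometricExtension {H K E : Type*} [Fintype H] [DecidableEq H] [Fintype K]
    [DecidableEq K] [Fintype E] (N : QuantumChannel H K) (U : Matrix (K × E) H ℂ) : Prop where
  isometry : U.conjTranspose * U = 1
  apply_eq : ∀ X : Matrix H H ℂ, N.apply X = partialTrace (U * X * U.conjTranspose)

/-- A density operator: positive semi-definite with trace one. -/
structure IsDensityOperator {H : Type*} [Fintype H] (ρ : Matrix H H ℂ) : Prop where
  posSemidef : ρ.PosSemidef
  trace_eq_one : ρ.trace = 1

/-- The support: the span of the eigenvectors whose eigenvalues are non-zero. -/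
def supp {H : Type*} [Fintype H] (A : Matrix H H ℂ) : Submodule ℂ (H → ℂ) :=
  Submodule.span ℂ {v | ∃ a : ℂ, a ≠ 0 ∧ A.mulVec v = a • v}

/-- The real power `A ^ s` of a positive semi-definite operator, evaluated on its support: every
non-zero eigenvalue `x` is replaced by `x ^ s`, and the eigenvalue `0` stays `0` (so `A ^ 0` is the
projection onto the support). -/
def suppPow {H : Type*} [Fintype H] [DecidableEq H] (A : Matrix H H ℂ) (s : ℝ) : Matrix H H ℂ :=
  cfc (fun x : ℝ => if x = 0 then 0 else x ^ s) A

/-- The operator absolute value `|A| = √(A† A)`. -/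
def absOp {m n : Type*} [Fintype m] [Fintype n] [DecidableEq n] (A : Matrix m n ℂ) :
    Matrix n n ℂ :=
  cfc Real.sqrt (A.conjTranspose * A)

/-- The Schatten norm `‖A‖_p = (Tr |A|^p)^(1/p)`. -/
def schattenNorm {m n : Type*} [Fintype m] [Fintype n] [DecidableEq n] (p : ℝ)
    (A : Matrix m n ℂ) : ℝ :=
  ((suppPow (absOp A) p).trace.re) ^ (1 / p)

/-- The swivels of `A`: the unitaries commuting with `A`. -/
def swivels {H : Type*} [Fintype H] [DecidableEq H] (A : Matrix H H ℂ) : Set (Matrix H H ℂ) :=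
  {V | V ∈ Matrix.unitaryGroup H ℂ ∧ V * A = A * V}

/-- The Schatten 2-norm
`‖ (N(ρ)^((1-α)/2) W N(σ)^((α-1)/2) ⊗ I_E) U σ^((1-α)/2) V ρ^(α/2) ‖_2`. -/
def swiveledNorm {H K E : Type*} [Fintype H] [DecidableEq H] [Fintype K] [DecidableEq K]
    [Fintype E] [DecidableEq E] (ρ σ : Matrix H H ℂ) (N : QuantumChannel H K)
    (U : Matrix (K × E) H ℂ) (α : ℝ) (V : Matrix H H ℂ) (W : Matrix K K ℂ) : ℝ :=
  schattenNorm 2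
    (((suppPow (N.apply ρ) ((1 - α) / 2) * W * suppPow (N.apply σ) ((α - 1) / 2)) ⊗ₖ
        (1 : Matrix E E ℂ)) * U * suppPow σ ((1 - α) / 2) * V * suppPow ρ (α / 2))

/-- The swiveled Rényi relative entropy difference
`Δ'_α(ρ, σ, N) = 2/(α-1) * max_{V, W} log ‖ ... ‖_2`, the maximum over the swivels `V` of `σ` and
`W` of `N(σ)`. Values are extended reals, with `log 0 = -∞`; the supremum is attained, as
`exists_isMax_swiveledNorm` shows. -/
def swiveledDiff {H K E : Type*} [Fintype H] [DecidableEq H] [Fintype K] [DecidableEq K]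
    [Fintype E] [DecidableEq E] (ρ σ : Matrix H H ℂ) (N : QuantumChannel H K)
    (U : Matrix (K × E) H ℂ) (α : ℝ) : EReal :=
  ((2 / (α - 1) : ℝ) : EReal) *
    ⨆ V ∈ swivels σ, ⨆ W ∈ swivels (N.apply σ),
      ENNReal.log (ENNReal.ofReal (swiveledNorm ρ σ N U α V W))

theorem schattenNorm_two {m n : Type*} [Fintype m] [Fintype n] [DecidableEq n]
    (A : Matrix m n ℂ) : schattenNorm 2 A = Real.sqrt ((A.conjTranspose * A).trace.re) := by
  have hA : (A.conjTranspose * A).PosSemidef := Matrix.posSemidef_conjTranspose_mul_self A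
  have hsa : IsSelfAdjoint (A.conjTranspose * A) := hA.isHermitian
  have hsp : ∀ x ∈ spectrum ℝ (A.conjTranspose * A), 0 ≤ x := by
    intro x hx
    rw [hA.isHermitian.spectrum_real_eq_range_eigenvalues] at hx
    obtain ⟨i, rfl⟩ := hx
    exact hA.eigenvalues_nonneg i
  have h : suppPow (absOp A) 2 = A.conjTranspose * A := by
    unfold suppPow absOp
    have hf : (fun x : ℝ => if x = 0 then 0 else x ^ (2 : ℝ)) = fun x : ℝ => x ^ 2 := by
      funext x
      split_ifs with h0
      · simp [h0]
      · simp
    rw [hf, ← cfc_comp' (fun x : ℝ => x ^ 2) Real.sqrt _ (by fun_prop) (by fun_prop) hsa]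
    conv_rhs => rw [← cfc_id ℝ (A.conjTranspose * A) hsa]
    exact cfc_congr fun x hx => Real.sq_sqrt (hsp x hx)
  rw [schattenNorm, h, Real.sqrt_eq_rpow]

theorem isCompact_swivels {H : Type*} [Fintype H] [DecidableEq H] (A : Matrix H H ℂ) :
    IsCompact (swivels A) := by
  have hc : IsClosed (swivels A) := by
    have : swivels A = {V | star V * V = 1} ∩ {V | V * star V = 1} ∩ {V | V * A = A * V} := by
      ext V
      simp [swivels, Matrix.unitaryGroup, Unitary.mem_iff]
    rw [this]
    refine (IsClosed.inter ?_ ?_).inter ?_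
    · exact isClosed_eq (by fun_prop) (by fun_prop)
    · exact isClosed_eq (by fun_prop) (by fun_prop)
    · exact isClosed_eq (by fun_prop) (by fun_prop)
  have hK : IsCompact (Set.univ.pi fun _ : H => Set.univ.pi fun _ : H =>
      Metric.closedBall (0 : ℂ) 1) :=
    isCompact_univ_pi fun _ => isCompact_univ_pi fun _ => isCompact_closedBall _ _
  refine hK.of_isClosed_subset hc fun V hV i _ j _ => ?_
  simpa using entry_norm_bound_of_unitary hV.1 i j

/-- The optimum over the swivels is attained. -/
theorem exists_isMax_swiveledNorm {H K E : Type*} [Fintype H] [DecidableEq H] [Fintype K]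
    [DecidableEq K] [Fintype E] [DecidableEq E] (ρ σ : Matrix H H ℂ) (N : QuantumChannel H K)
    (U : Matrix (K × E) H ℂ) (α : ℝ) :
    ∃ V ∈ swivels σ, ∃ W ∈ swivels (N.apply σ),
      (∀ V' ∈ swivels σ, ∀ W' ∈ swivels (N.apply σ),
        swiveledNorm ρ σ N U α V' W' ≤ swiveledNorm ρ σ N U α V W) ∧
      swiveledDiff ρ σ N U α = ((2 / (α - 1) : ℝ) : EReal) *
        ENNReal.log (ENNReal.ofReal (swiveledNorm ρ σ N U α V W)) := by
  have hcomp := (isCompact_swivels σ).prod (isCompact_swivels (N.apply σ))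
  have hne : (swivels σ ×ˢ swivels (N.apply σ)).Nonempty :=
    ⟨(1, 1), ⟨by simp [swivels, one_mem], by simp [swivels, one_mem]⟩⟩
  have hcont : Continuous fun p : Matrix H H ℂ × Matrix K K ℂ =>
      swiveledNorm ρ σ N U α p.1 p.2 := by
    simp only [swiveledNorm, schattenNorm_two, Matrix.trace, Matrix.diag]
    have hk : Continuous fun p : Matrix H H ℂ × Matrix K K ℂ =>
        (suppPow (N.apply ρ) ((1 - α) / 2) * p.2 * suppPow (N.apply σ) ((α - 1) / 2)) ⊗ₖ
          (1 : Matrix E E ℂ) := by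
      refine continuous_pi fun i => continuous_pi fun j => ?_
      simp only [Matrix.kroneckerMap_apply]
      fun_prop
    fun_prop
  obtain ⟨⟨V, W⟩, ⟨hV, hW⟩, hmax⟩ := hcomp.exists_isMaxOn hne hcont.continuousOn
  have hm : ∀ V' ∈ swivels σ, ∀ W' ∈ swivels (N.apply σ),
      swiveledNorm ρ σ N U α V' W' ≤ swiveledNorm ρ σ N U α V W :=
    fun V' hV' W' hW' => hmax (a := (V', W')) ⟨hV', hW'⟩
  refine ⟨V, hV, W, hW, hm, ?_⟩
  unfold swiveledDiff
  congr 1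
  refine le_antisymm ?_ ?_
  · exact iSup₂_le fun V' hV' => iSup₂_le fun W' hW' =>
      ENNReal.log_monotone (ENNReal.ofReal_le_ofReal (hm V' hV' W' hW'))
  · exact le_iSup₂_of_le V hV (le_iSup₂_of_le W hW le_rfl)

end SwiveledRenyi

end

/-! Let Z(α) be the maximum over swivels of the 2-norm. Everything follows from log Z being convex
in α, with Z(1) ≤ 1. Convexity is complex interpolation. With a complex order z = x + iy, each power
splits as A^(x+iy) = A^(iy) A^x, where A^(iy) is a unitary commuting with A. The phases of ρ and
N(ρ) sit at the outer ends and vanish by unitary invariance; those of σ and N(σ) stand next to the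
swivels and turn them into other swivels. So Z(x) bounds the norm on the whole line re z = x, and
Hadamard's three-line theorem applies (`swiveledNorm_three_lines`). At α = 1 the operator is a
product of projections and isometries applied to ρ^(1/2), whence Z(1) ≤ 1, with equality if supp ρ ≤
supp σ. Thus Δ' is twice the slope of a convex function seen from 1 when log Z(1) = 0; log Z(1) ≤ 0
suffices on each side separately (`monotoneOn_log_div`). -/

noncomputable section

namespace SwiveledRenyi

open scoped Kronecker ComplexOrder
open Matrix

/-! ### Real, complex and imaginary powers on the support -/

section SpectralMap

variable {n : Type*} [Fintype n] [DecidableEq n] {A : Matrix n n ℂ}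

/-- The complex-valued functional calculus of a Hermitian matrix. -/
def spectralMap (hA : A.IsHermitian) (f : ℝ → ℂ) : Matrix n n ℂ :=
  (hA.eigenvectorUnitary : Matrix n n ℂ) * diagonal (fun i => f (hA.eigenvalues i)) *
    star (hA.eigenvectorUnitary : Matrix n n ℂ)

theorem spectralMap_mul (hA : A.IsHermitian) (f g : ℝ → ℂ) :
    spectralMap hA f * spectralMap hA g = spectralMap hA fun x => f x * g x := by
  have h : star (hA.eigenvectorUnitary : Matrix n n ℂ) * hA.eigenvectorUnitary = 1 :=
    Unitary.coe_star_mul_self _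
  unfold spectralMap
  rw [← diagonal_mul_diagonal]
  simp only [Matrix.mul_assoc]
  rw [← Matrix.mul_assoc (star (hA.eigenvectorUnitary : Matrix n n ℂ)), h, Matrix.one_mul]

theorem spectralMap_comm (hA : A.IsHermitian) (f g : ℝ → ℂ) :
    spectralMap hA f * spectralMap hA g = spectralMap hA g * spectralMap hA f := by
  simp only [spectralMap_mul, mul_comm]

theorem spectralMap_one (hA : A.IsHermitian) : spectralMap hA (fun _ => 1) = 1 := by
  unfold spectralMap
  rw [diagonal_one, Matrix.mul_one]
  exact Unitary.coe_mul_star_self _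

theorem spectralMap_conjTranspose (hA : A.IsHermitian) (f : ℝ → ℂ) :
    (spectralMap hA f)ᴴ = spectralMap hA fun x => star (f x) := by
  unfold spectralMap
  simp only [conjTranspose_mul, diagonal_conjTranspose, star_eq_conjTranspose,
    conjTranspose_conjTranspose, Matrix.mul_assoc]
  rfl

theorem spectralMap_congr (hA : A.IsHermitian) {f g : ℝ → ℂ}
    (h : ∀ i, f (hA.eigenvalues i) = g (hA.eigenvalues i)) :
    spectralMap hA f = spectralMap hA g := by
  unfold spectralMap
  simp only [h]

theorem spectralMap_ofReal (hA : A.IsHermitian) : spectralMap hA (fun x => (x : ℂ)) = A := by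
  conv_rhs => rw [hA.spectral_theorem, Unitary.conjStarAlgAut_apply]
  rfl

theorem spectralMap_mem_unitaryGroup (hA : A.IsHermitian) {f : ℝ → ℂ}
    (h : ∀ x, star (f x) * f x = 1) : spectralMap hA f ∈ unitaryGroup n ℂ := by
  rw [mem_unitaryGroup_iff', star_eq_conjTranspose, spectralMap_conjTranspose, spectralMap_mul]
  simp only [h, spectralMap_one]

theorem suppPow_eq_spectralMap (hA : A.IsHermitian) (s : ℝ) :
    suppPow A s = spectralMap hA fun x => ((if x = 0 then 0 else x ^ s : ℝ) : ℂ) := by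
  unfold suppPow
  rw [hA.cfc_eq, IsHermitian.cfc, Unitary.conjStarAlgAut_apply]
  rfl

theorem suppPow_conjTranspose (hA : A.IsHermitian) (s : ℝ) : (suppPow A s)ᴴ = suppPow A s := by
  simp [suppPow_eq_spectralMap hA, spectralMap_conjTranspose]

/-- No sign condition on s and t is needed: zero eigenvalues stay zero on both sides, and the others
are positive. -/
theorem suppPow_add (hA : A.PosSemidef) (s t : ℝ) :
    suppPow A s * suppPow A t = suppPow A (s + t) := by
  simp only [suppPow_eq_spectralMap hA.isHermitian, spectralMap_mul]
  refine spectralMap_congr _ fun i => ?_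
  split_ifs with h
  · simp
  · rw [Real.rpow_add ((hA.eigenvalues_nonneg i).lt_of_ne' h)]
    push_cast
    rfl

theorem suppPow_one (hA : A.PosSemidef) : suppPow A 1 = A := by
  conv_rhs => rw [← spectralMap_ofReal hA.isHermitian]
  rw [suppPow_eq_spectralMap hA.isHermitian]
  refine spectralMap_congr _ fun i => ?_
  split_ifs with h <;> simp [h]

/-- The complex power `A ^ z` of a positive semidefinite matrix on its support. -/
def suppCPow (hA : A.IsHermitian) (z : ℂ) : Matrix n n ℂ :=
  spectralMap hA fun x => if x = 0 then 0 else (x : ℂ) ^ z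

/-- The unitary `A ^ (i t)`, extended by the identity outside the support. -/
def imagPow (hA : A.IsHermitian) (t : ℝ) : Matrix n n ℂ :=
  spectralMap hA fun x => Complex.exp ((t * Real.log x : ℝ) * Complex.I)

/-- `Real.log 0 = 0` makes the phase 1 on the kernel, so the result is unitary on the whole space,
as a swivel must be. -/
theorem imagPow_mem_unitaryGroup (hA : A.IsHermitian) (t : ℝ) :
    imagPow hA t ∈ unitaryGroup n ℂ := by
  refine spectralMap_mem_unitaryGroup hA fun x => ?_
  rw [Complex.star_def, ← Complex.normSq_eq_conj_mul_self, Complex.normSq_eq_norm_sq,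
    Complex.norm_exp_ofReal_mul_I]
  simp

theorem imagPow_comm (hA : A.IsHermitian) (t : ℝ) : imagPow hA t * A = A * imagPow hA t := by
  have h := spectralMap_comm hA (fun x => Complex.exp ((t * Real.log x : ℝ) * Complex.I))
    fun x => (x : ℂ)
  rwa [spectralMap_ofReal] at h

theorem suppCPow_eq_imagPow_mul (hA : A.PosSemidef) (z : ℂ) :
    suppCPow hA.isHermitian z = imagPow hA.isHermitian z.im * suppPow A z.re := by
  rw [suppPow_eq_spectralMap hA.isHermitian, suppCPow, imagPow, spectralMap_mul]
  refine spectralMap_congr _ fun i => ?_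
  split_ifs with h
  -- On the kernel the phase is 1, but the factor `suppPow` kills it.
  · simp
  · have hx := (hA.eigenvalues_nonneg i).lt_of_ne' h
    have hc : ((hA.isHermitian.eigenvalues i : ℝ) : ℂ) ≠ 0 := by exact_mod_cast h
    rw [Real.rpow_def_of_pos hx, Complex.cpow_def_of_ne_zero hc, Complex.ofReal_exp,
      ← Complex.exp_add, ← Complex.ofReal_log hx.le]
    congr 1
    conv_lhs => rw [← Complex.re_add_im z]
    push_cast
    ring

theorem suppCPow_eq_mul_imagPow (hA : A.PosSemidef) (z : ℂ) :
    suppCPow hA.isHermitian z = suppPow A z.re * imagPow hA.isHermitian z.im := by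
  rw [suppCPow_eq_imagPow_mul hA, suppPow_eq_spectralMap hA.isHermitian]
  exact spectralMap_comm _ _ _

theorem suppCPow_ofReal (hA : A.PosSemidef) (s : ℝ) :
    suppCPow hA.isHermitian s = suppPow A s := by
  rw [suppPow_eq_spectralMap hA.isHermitian, suppCPow]
  refine spectralMap_congr _ fun i => ?_
  split_ifs with h
  · simp
  · rw [Complex.ofReal_cpow (hA.eigenvalues_nonneg i)]

end SpectralMap

/-! ### Entire functions bounded on a strip -/

section BoundedEntire

/-- The entire functions that are bounded on the closed vertical strip `l ≤ re z ≤ u`. -/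
def BoundedEntire (l u : ℝ) (f : ℂ → ℂ) : Prop :=
  Differentiable ℂ f ∧ ∃ C, ∀ z : ℂ, z.re ∈ Set.Icc l u → ‖f z‖ ≤ C

variable {l u : ℝ} {f g : ℂ → ℂ}

theorem BoundedEntire.const (c : ℂ) : BoundedEntire l u fun _ => c :=
  ⟨differentiable_const c, ‖c‖, fun _ _ => le_rfl⟩

theorem BoundedEntire.add (hf : BoundedEntire l u f) (hg : BoundedEntire l u g) :
    BoundedEntire l u fun z => f z + g z := by
  obtain ⟨hf, C, hC⟩ := hf
  obtain ⟨hg, D, hD⟩ := hg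
  exact ⟨hf.add hg, C + D, fun z hz => (norm_add_le _ _).trans (add_le_add (hC z hz) (hD z hz))⟩

theorem BoundedEntire.mul (hf : BoundedEntire l u f) (hg : BoundedEntire l u g) :
    BoundedEntire l u fun z => f z * g z := by
  obtain ⟨hf, C, hC⟩ := hf
  obtain ⟨hg, D, hD⟩ := hg
  refine ⟨hf.mul hg, C * D, fun z hz => ?_⟩
  rw [norm_mul]
  exact mul_le_mul (hC z hz) (hD z hz) (norm_nonneg _) ((norm_nonneg _).trans (hC z hz))

theorem BoundedEntire.sum {ι : Type*} (s : Finset ι) {f : ι → ℂ → ℂ}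
    (hf : ∀ i ∈ s, BoundedEntire l u (f i)) : BoundedEntire l u fun z => ∑ i ∈ s, f i z := by
  classical
  induction s using Finset.induction_on with
  | empty => simpa using BoundedEntire.const 0
  | insert i s hi ih =>
    simp only [Finset.sum_insert hi]
    exact (hf i (by simp)).add (ih fun j hj => hf j (by simp [hj]))

/-- The modulus depends only on re z, which ranges over a compact interval. -/
theorem BoundedEntire.cpow {x : ℝ} (hx : 0 < x) (a b : ℝ) :
    BoundedEntire l u fun z => (x : ℂ) ^ ((a : ℂ) * z + b) := by
  have hc : (x : ℂ) ≠ 0 := by exact_mod_cast hx.ne'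
  refine ⟨fun z => ?_, ?_⟩
  · exact (DifferentiableAt.const_cpow (by fun_prop) (Or.inl hc))
  · have hcont : ContinuousOn (fun t : ℝ => x ^ (a * t + b)) (Set.Icc l u) := by
      refine Continuous.continuousOn ?_
      exact continuous_const.rpow (by fun_prop) fun _ => Or.inl hx.ne'
    obtain ⟨C, hC⟩ := isCompact_Icc.exists_bound_of_continuousOn hcont
    refine ⟨C, fun z hz => ?_⟩
    rw [Complex.norm_cpow_eq_rpow_re_of_pos hx]
    have := hC z.re hz
    rw [Real.norm_of_nonneg (Real.rpow_nonneg hx.le _)] at this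
    simpa using this

/-- Matrix-valued functions whose entries are entire and bounded on a vertical strip. -/
def BoundedEntireMatrix (l u : ℝ) {m n : Type*} (M : ℂ → Matrix m n ℂ) : Prop :=
  ∀ i j, BoundedEntire l u fun z => M z i j

theorem BoundedEntireMatrix.const {m n : Type*} (M : Matrix m n ℂ) :
    BoundedEntireMatrix l u fun _ => M :=
  fun i j => BoundedEntire.const (M i j)

theorem BoundedEntireMatrix.mul {m n p : Type*} [Fintype n] {M : ℂ → Matrix m n ℂ}
    {M' : ℂ → Matrix n p ℂ} (h : BoundedEntireMatrix l u M) (h' : BoundedEntireMatrix l u M') :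
    BoundedEntireMatrix l u fun z => M z * M' z := fun i j => by
  simp only [Matrix.mul_apply]
  exact BoundedEntire.sum _ fun k _ => (h i k).mul (h' k j)

theorem BoundedEntireMatrix.kronecker {m n p q : Type*} {M : ℂ → Matrix m n ℂ}
    {M' : ℂ → Matrix p q ℂ} (h : BoundedEntireMatrix l u M) (h' : BoundedEntireMatrix l u M') :
    BoundedEntireMatrix l u fun z => M z ⊗ₖ M' z := fun i j => by
  simp only [Matrix.kroneckerMap_apply]
  exact (h _ _).mul (h' _ _)

theorem BoundedEntireMatrix.suppCPow {n : Type*} [Fintype n] [DecidableEq n] {A : Matrix n n ℂ}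
    (hA : A.PosSemidef) (a b : ℝ) :
    BoundedEntireMatrix l u fun z => suppCPow hA.isHermitian ((a : ℂ) * z + b) := by
  refine (BoundedEntireMatrix.mul (.const _) fun i j => ?_).mul (.const _)
  simp only [diagonal_apply]
  split_ifs with h1 h2
  · exact .const 0
  · exact .cpow ((hA.eigenvalues_nonneg i).lt_of_ne' h2) a b
  · exact .const 0

end BoundedEntire

/-! ### The Schatten 2-norm and the three-line theorem -/

section SchattenTwo

variable {m n : Type*} [Fintype m] [Fintype n] [DecidableEq n]

/-- Passing to the Euclidean norm of the entries lets the vector-valued three-line theorem apply. -/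
theorem schattenNorm_two_eq_norm (A : Matrix m n ℂ) :
    schattenNorm 2 A = ‖WithLp.toLp 2 fun p : m × n => A p.1 p.2‖ := by
  rw [schattenNorm_two, EuclideanSpace.norm_eq]
  congr 1
  simp only [Matrix.trace, Matrix.diag, Matrix.mul_apply, Complex.re_sum, Fintype.sum_prod_type]
  rw [Finset.sum_comm]
  refine Finset.sum_congr rfl fun i _ => Finset.sum_congr rfl fun j _ => ?_
  rw [conjTranspose_apply, Complex.star_def, ← Complex.normSq_eq_conj_mul_self,
    Complex.normSq_eq_norm_sq, Complex.ofReal_re]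

theorem schattenNorm_two_nonneg (A : Matrix m n ℂ) : 0 ≤ schattenNorm 2 A := by
  rw [schattenNorm_two_eq_norm]
  exact norm_nonneg _

theorem schattenNorm_two_isometry_mul {p : Type*} [Fintype p] {Q : Matrix p m ℂ} [DecidableEq m]
    (hQ : Qᴴ * Q = 1) (A : Matrix m n ℂ) : schattenNorm 2 (Q * A) = schattenNorm 2 A := by
  rw [schattenNorm_two, schattenNorm_two, conjTranspose_mul, Matrix.mul_assoc,
    ← Matrix.mul_assoc Qᴴ, hQ, Matrix.one_mul]

theorem schattenNorm_two_mul_unitary (A : Matrix m n ℂ) {V : Matrix n n ℂ}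
    (hV : V ∈ unitaryGroup n ℂ) : schattenNorm 2 (A * V) = schattenNorm 2 A := by
  have h : V * Vᴴ = 1 := mem_unitaryGroup_iff.1 hV
  rw [schattenNorm_two, schattenNorm_two, conjTranspose_mul, Matrix.mul_assoc, trace_mul_comm,
    Matrix.mul_assoc, Matrix.mul_assoc, h, Matrix.mul_one]

theorem schattenNorm_two_projection_mul_le [DecidableEq m] {P : Matrix m m ℂ} (hP : Pᴴ = P)
    (hPP : P * P = P) (A : Matrix m n ℂ) : schattenNorm 2 (P * A) ≤ schattenNorm 2 A := by
  rw [schattenNorm_two, schattenNorm_two]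
  refine Real.sqrt_le_sqrt ?_
  -- Pythagoras for the orthogonal projections P and 1 - P.
  have key : Aᴴ * A = (P * A)ᴴ * (P * A) + ((1 - P) * A)ᴴ * ((1 - P) * A) := by
    simp only [conjTranspose_mul, conjTranspose_sub, conjTranspose_one, hP]
    have h1 : P * (P * A) = P * A := by rw [← Matrix.mul_assoc, hPP]
    simp only [Matrix.sub_mul, Matrix.mul_sub, Matrix.one_mul, Matrix.mul_one, Matrix.mul_assoc, h1]
    abel
  rw [key, trace_add, Complex.add_re]
  have := (posSemidef_conjTranspose_mul_self ((1 - P) * A)).trace_nonneg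
  linarith [(Complex.le_def.1 this).1, Complex.zero_re]

/-- Hadamard's three-line theorem for the Schatten 2-norm. -/
theorem schattenNorm_two_three_lines {l u : ℝ} (hlu : l < u) {M : ℂ → Matrix m n ℂ}
    (hM : BoundedEntireMatrix l u M) {a b : ℝ}
    (ha : ∀ z : ℂ, z.re = l → schattenNorm 2 (M z) ≤ a)
    (hb : ∀ z : ℂ, z.re = u → schattenNorm 2 (M z) ≤ b) {z : ℂ} (hz : z.re ∈ Set.Icc l u) :
    schattenNorm 2 (M z) ≤ a ^ (1 - (z.re - l) / (u - l)) * b ^ ((z.re - l) / (u - l)) := by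
  simp only [schattenNorm_two_eq_norm] at ha hb ⊢
  refine Complex.HadamardThreeLines.norm_le_interp_of_mem_verticalClosedStrip'
    (f := fun z => WithLp.toLp 2 fun p : m × n => M z p.1 p.2) hlu hz ?_ ?_ ha hb
  · refine Differentiable.diffContOnCl ?_
    rw [differentiable_euclidean]
    exact fun p => (hM p.1 p.2).1
  · choose C hC using fun p : m × n => (hM p.1 p.2).2
    refine ⟨√(∑ p, C p ^ 2), ?_⟩
    rintro _ ⟨w, hw, rfl⟩
    simp only [Function.comp_apply, EuclideanSpace.norm_eq]
    exact Real.sqrt_le_sqrt (Finset.sum_le_sum fun p _ =>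
      pow_le_pow_left₀ (norm_nonneg _) (hC p w hw) 2)

end SchattenTwo

/-! ### Partial trace -/

section PartialTrace

variable {K E : Type*} [Fintype E]

theorem partialTrace_posSemidef {X : Matrix (K × E) (K × E) ℂ} (hX : X.PosSemidef) :
    (partialTrace X).PosSemidef := by
  have h : partialTrace X = ∑ e, X.submatrix (fun k => (k, e)) fun k => (k, e) := by
    ext k l
    simp [partialTrace, Matrix.sum_apply]
  rw [h]
  exact posSemidef_sum _ fun e _ => hX.submatrix _

theorem trace_kronecker_one_mul [Fintype K] [DecidableEq E] (P : Matrix K K ℂ)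
    (X : Matrix (K × E) (K × E) ℂ) :
    ((P ⊗ₖ (1 : Matrix E E ℂ)) * X).trace = (P * partialTrace X).trace := by
  simp only [Matrix.trace, Matrix.diag, Matrix.mul_apply, Fintype.sum_prod_type,
    kroneckerMap_apply, partialTrace, Matrix.of_apply, Matrix.one_apply, mul_ite, mul_one, mul_zero,
    ite_mul, zero_mul, Finset.sum_ite_eq, Finset.mem_univ, if_true, Finset.mul_sum]
  exact Finset.sum_congr rfl fun k _ => Finset.sum_comm

theorem mul_kronecker_one [Fintype K] [DecidableEq E] (A B : Matrix K K ℂ) :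
    (A * B) ⊗ₖ (1 : Matrix E E ℂ) =
      (A ⊗ₖ (1 : Matrix E E ℂ)) * (B ⊗ₖ (1 : Matrix E E ℂ)) := by
  rw [← mul_kronecker_mul, Matrix.one_mul]

theorem IsIsometricExtension.apply_posSemidef {H : Type*} [Fintype H] [DecidableEq H] [Fintype K]
    [DecidableEq K] {N : QuantumChannel H K} {U : Matrix (K × E) H ℂ} (hU : IsIsometricExtension N U)
    {X : Matrix H H ℂ} (hX : X.PosSemidef) : (N.apply X).PosSemidef := by
  rw [hU.apply_eq]
  exact partialTrace_posSemidef (hX.mul_mul_conjTranspose_same U)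

end PartialTrace

/-! ### Supports and the value at order 1 -/

section Channel

variable {H K E : Type*} [Fintype H] [DecidableEq H] [Fintype K] [DecidableEq K]
  [Fintype E] [DecidableEq E] {ρ σ : Matrix H H ℂ} {N : QuantumChannel H K}
  {U : Matrix (K × E) H ℂ}

/-- A projection fixing the output `N(Y Y†)` fixes `U Y`. -/
theorem kronecker_one_mul_eq_of_apply_eq (hU : IsIsometricExtension N U) {P : Matrix K K ℂ}
    (hP : Pᴴ = P) (hPP : P * P = P) (Y : Matrix H H ℂ)
    (h : P * N.apply (Y * Yᴴ) = N.apply (Y * Yᴴ)) :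
    (P ⊗ₖ (1 : Matrix E E ℂ)) * (U * Y) = U * Y := by
  have hQQ : (1 - P)ᴴ * (1 - P) = 1 - P := by
    rw [conjTranspose_sub, conjTranspose_one, hP]
    simp [Matrix.sub_mul, Matrix.mul_sub, hPP]
  have hsub : ((1 - P) ⊗ₖ (1 : Matrix E E ℂ)) * (U * Y) =
      U * Y - (P ⊗ₖ (1 : Matrix E E ℂ)) * (U * Y) := by
    rw [eq_sub_iff_add_eq, ← Matrix.add_mul, ← add_kronecker, sub_add_cancel, one_kronecker_one,
      Matrix.one_mul]
  suffices hz : ((1 - P) ⊗ₖ (1 : Matrix E E ℂ)) * (U * Y) = 0 by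
    rw [hz] at hsub
    exact (sub_eq_zero.1 hsub.symm).symm
  -- The squared 2-norm equals Tr{(1 - P) N(Y Y†)}, which `h` makes zero.
  rw [← trace_conjTranspose_mul_self_eq_zero_iff, conjTranspose_mul, Matrix.mul_assoc,
    trace_mul_comm, ← Matrix.mul_assoc, conjTranspose_kronecker, conjTranspose_one,
    ← mul_kronecker_mul, hQQ, Matrix.one_mul, Matrix.mul_assoc, trace_kronecker_one_mul,
    conjTranspose_mul, ← Matrix.mul_assoc (U * Y), Matrix.mul_assoc U, ← hU.apply_eq,
    Matrix.sub_mul, h, Matrix.one_mul, sub_self, trace_zero]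

theorem suppPow_zero_mul (hσ : σ.PosSemidef) : suppPow σ 0 * σ = σ := by
  have h := suppPow_add hσ 0 1
  rwa [zero_add, suppPow_one hσ] at h

/-- The projection σ^0 fixes every eigenvector of σ with non-zero eigenvalue, hence all of supp σ;
the identity is then checked on an eigenbasis of ρ. -/
theorem suppPow_zero_mul_of_supp_le (hρ : ρ.PosSemidef) (hσ : σ.PosSemidef)
    (h : supp ρ ≤ supp σ) : suppPow σ 0 * ρ = ρ := by
  have hfix : ∀ v ∈ supp σ, suppPow σ 0 *ᵥ v = v := by
    intro v hv
    induction hv using Submodule.span_induction with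
    | mem v hv =>
      obtain ⟨a, ha, hav⟩ := hv
      have h2 : a • (suppPow σ 0 *ᵥ v) = a • v := by
        rw [← mulVec_smul, ← hav, mulVec_mulVec, suppPow_zero_mul hσ]
      exact smul_right_injective _ ha h2
    | zero => simp
    | add x y _ _ hx hy => rw [mulVec_add, hx, hy]
    | smul a x _ hx => rw [mulVec_smul, hx]
  have hH := hρ.isHermitian
  have hbasis : ∀ i, suppPow σ 0 *ᵥ (ρ *ᵥ (hH.eigenvectorBasis i).ofLp) =
      ρ *ᵥ (hH.eigenvectorBasis i).ofLp := by
    intro i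
    by_cases hi : hH.eigenvalues i = 0
    · rw [hH.mulVec_eigenvectorBasis, hi]
      simp
    · refine hfix _ (h ?_)
      rw [hH.mulVec_eigenvectorBasis]
      refine Submodule.smul_mem _ (hH.eigenvalues i : ℂ)
        (Submodule.subset_span ⟨hH.eigenvalues i, ?_, ?_⟩)
      · exact_mod_cast hi
      · exact hH.mulVec_eigenvectorBasis i
  have hmul : suppPow σ 0 * ρ * (hH.eigenvectorUnitary : Matrix H H ℂ) =
      ρ * (hH.eigenvectorUnitary : Matrix H H ℂ) := by
    ext i j
    have := congrFun (hbasis j) i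
    rw [mulVec_mulVec] at this
    exact this
  have hu : (hH.eigenvectorUnitary : Matrix H H ℂ) * star (hH.eigenvectorUnitary : Matrix H H ℂ) = 1 :=
    Unitary.coe_mul_star_self _
  have := congrArg (· * star (hH.eigenvectorUnitary : Matrix H H ℂ)) hmul
  simpa only [Matrix.mul_assoc, hu, Matrix.mul_one] using this

theorem schattenNorm_two_suppPow_half (hρ : IsDensityOperator ρ) :
    schattenNorm 2 (suppPow ρ (1 / 2)) = 1 := by
  rw [schattenNorm_two, suppPow_conjTranspose hρ.posSemidef.isHermitian, suppPow_add hρ.posSemidef]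
  norm_num [suppPow_one hρ.posSemidef, hρ.trace_eq_one]

theorem suppPow_zero_mul_self (hσ : σ.PosSemidef) : suppPow σ 0 * suppPow σ 0 = suppPow σ 0 := by
  rw [suppPow_add hσ, add_zero]

theorem one_mem_swivels (A : Matrix H H ℂ) : 1 ∈ swivels A := ⟨one_mem _, by simp⟩

theorem mul_imagPow_mem_swivels {A V : Matrix H H ℂ} (hA : A.IsHermitian) (hV : V ∈ swivels A)
    (t : ℝ) : V * imagPow hA t ∈ swivels A :=
  ⟨mul_mem hV.1 (imagPow_mem_unitaryGroup hA t), by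
    rw [Matrix.mul_assoc, imagPow_comm, ← Matrix.mul_assoc, hV.2, Matrix.mul_assoc]⟩

theorem imagPow_mul_mem_swivels {A V : Matrix H H ℂ} (hA : A.IsHermitian) (hV : V ∈ swivels A)
    (t : ℝ) : imagPow hA t * V ∈ swivels A :=
  ⟨mul_mem (imagPow_mem_unitaryGroup hA t) hV.1, by
    rw [Matrix.mul_assoc, hV.2, ← Matrix.mul_assoc, imagPow_comm, Matrix.mul_assoc]⟩

theorem kronecker_one_conjTranspose_mul_self {W : Matrix K K ℂ} (hW : W ∈ unitaryGroup K ℂ) :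
    (W ⊗ₖ (1 : Matrix E E ℂ))ᴴ * (W ⊗ₖ (1 : Matrix E E ℂ)) = 1 := by
  have h : Wᴴ * W = 1 := mem_unitaryGroup_iff'.1 hW
  rw [conjTranspose_kronecker, conjTranspose_one, ← mul_kronecker_mul, h, Matrix.one_mul,
    one_kronecker_one]

theorem kronecker_one_suppPow_zero_mul_le {A : Matrix K K ℂ} (hA : A.PosSemidef)
    (X : Matrix (K × E) H ℂ) :
    schattenNorm 2 ((suppPow A 0 ⊗ₖ (1 : Matrix E E ℂ)) * X) ≤ schattenNorm 2 X := by
  refine schattenNorm_two_projection_mul_le ?_ ?_ X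
  · rw [conjTranspose_kronecker, conjTranspose_one, suppPow_conjTranspose hA.isHermitian]
  · rw [← mul_kronecker_mul, suppPow_zero_mul_self hA, Matrix.one_mul]

/-- At order 1 the powers of N(ρ), N(σ) and σ are support projections, which contract; V, W and U
preserve the norm, and ρ^(1/2) has norm 1. -/
theorem swiveledNorm_one_le (hρ : IsDensityOperator ρ) (hσ : σ.PosSemidef)
    (hU : IsIsometricExtension N U) {V : Matrix H H ℂ} (hV : V ∈ swivels σ) {W : Matrix K K ℂ}
    (hW : W ∈ swivels (N.apply σ)) : swiveledNorm ρ σ N U 1 V W ≤ 1 := by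
  unfold swiveledNorm
  rw [sub_self, zero_div, mul_kronecker_one, mul_kronecker_one]
  simp only [Matrix.mul_assoc]
  refine (kronecker_one_suppPow_zero_mul_le (hU.apply_posSemidef hρ.posSemidef) _).trans ?_
  rw [schattenNorm_two_isometry_mul (kronecker_one_conjTranspose_mul_self hW.1)]
  refine (kronecker_one_suppPow_zero_mul_le (hU.apply_posSemidef hσ) _).trans ?_
  rw [schattenNorm_two_isometry_mul hU.isometry]
  refine (schattenNorm_two_projection_mul_le (suppPow_conjTranspose hσ.isHermitian 0)
    (suppPow_zero_mul_self hσ) _).trans ?_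
  rw [schattenNorm_two_isometry_mul (mem_unitaryGroup_iff'.1 hV.1),
    schattenNorm_two_suppPow_half hρ]

theorem suppPow_half_mul_conjTranspose (hσ : σ.PosSemidef) :
    suppPow σ (1 / 2) * (suppPow σ (1 / 2))ᴴ = σ := by
  rw [suppPow_conjTranspose hσ.isHermitian, suppPow_add hσ, add_halves, suppPow_one hσ]

theorem kronecker_one_suppPow_zero_mul_eq (hU : IsIsometricExtension N U) (hσ : σ.PosSemidef) :
    (suppPow (N.apply σ) 0 ⊗ₖ (1 : Matrix E E ℂ)) * (U * suppPow σ (1 / 2)) =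
      U * suppPow σ (1 / 2) := by
  have hN := hU.apply_posSemidef hσ
  refine kronecker_one_mul_eq_of_apply_eq hU (suppPow_conjTranspose hN.isHermitian 0)
    (suppPow_zero_mul_self hN) _ ?_
  rw [suppPow_half_mul_conjTranspose hσ, suppPow_zero_mul hN]

/-- With trivial swivels, each of the three support projections acts as the identity on what stands
to its right. -/
theorem swiveledNorm_one_one_one (hρ : IsDensityOperator ρ) (hσ : σ.PosSemidef)
    (hU : IsIsometricExtension N U) (h : supp ρ ≤ supp σ) :
    swiveledNorm ρ σ N U 1 1 1 = 1 := by
  have hρ' : suppPow σ 0 * suppPow ρ (1 / 2) = suppPow ρ (1 / 2) := by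
    have h1 := suppPow_add hρ.posSemidef 1 (-1 / 2)
    rw [suppPow_one hρ.posSemidef] at h1
    rw [show (1 : ℝ) + -1 / 2 = 1 / 2 by norm_num] at h1
    rw [← h1, ← Matrix.mul_assoc, suppPow_zero_mul_of_supp_le hρ.posSemidef hσ h]
  have hσ' : (suppPow (N.apply σ) 0 ⊗ₖ (1 : Matrix E E ℂ)) * (U * suppPow ρ (1 / 2)) =
      U * suppPow ρ (1 / 2) := by
    -- Factoring through σ^(1/2) reduces the claim to the fact that N(σ)^0 ⊗ I fixes U σ^(1/2).
    have h2 : suppPow ρ (1 / 2) = suppPow σ (1 / 2) * (suppPow σ (-1 / 2) * suppPow ρ (1 / 2)) := by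
      rw [← Matrix.mul_assoc, suppPow_add hσ,
        show (1 / 2 : ℝ) + -1 / 2 = 0 by norm_num, hρ']
    rw [h2, ← Matrix.mul_assoc U, ← Matrix.mul_assoc, kronecker_one_suppPow_zero_mul_eq hU hσ]
  unfold swiveledNorm
  rw [sub_self, zero_div, mul_kronecker_one, mul_kronecker_one]
  simp only [Matrix.mul_assoc, one_kronecker_one, Matrix.one_mul]
  rw [hρ', hσ', kronecker_one_suppPow_zero_mul_eq hU hρ.posSemidef,
    schattenNorm_two_isometry_mul hU.isometry, schattenNorm_two_suppPow_half hρ]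

/-! ### Complex interpolation in the order -/

/-- The swiveled operator at a complex order `z`. -/
def swiveledCPow (hρ : ρ.IsHermitian) (hσ : σ.IsHermitian) (hNρ : (N.apply ρ).IsHermitian)
    (hNσ : (N.apply σ).IsHermitian) (U : Matrix (K × E) H ℂ) (V : Matrix H H ℂ) (W : Matrix K K ℂ)
    (z : ℂ) : Matrix (K × E) H ℂ :=
  ((suppCPow hNρ ((1 - z) / 2) * W * suppCPow hNσ ((z - 1) / 2)) ⊗ₖ (1 : Matrix E E ℂ)) * U *
    suppCPow hσ ((1 - z) / 2) * V * suppCPow hρ (z / 2)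

theorem boundedEntireMatrix_swiveledCPow (hρ : ρ.PosSemidef) (hσ : σ.PosSemidef)
    (hNρ : (N.apply ρ).PosSemidef) (hNσ : (N.apply σ).PosSemidef) (U : Matrix (K × E) H ℂ)
    (V : Matrix H H ℂ) (W : Matrix K K ℂ) (l u : ℝ) :
    BoundedEntireMatrix l u (swiveledCPow hρ.isHermitian hσ.isHermitian hNρ.isHermitian
      hNσ.isHermitian U V W) := by
  have e1 : ∀ z : ℂ, (1 - z) / 2 = ((-1 / 2 : ℝ) : ℂ) * z + (1 / 2 : ℝ) := fun z => by
    push_cast; ring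
  have e2 : ∀ z : ℂ, (z - 1) / 2 = ((1 / 2 : ℝ) : ℂ) * z + (-1 / 2 : ℝ) := fun z => by
    push_cast; ring
  have e3 : ∀ z : ℂ, z / 2 = ((1 / 2 : ℝ) : ℂ) * z + (0 : ℝ) := fun z => by
    push_cast; ring
  unfold swiveledCPow
  simp only [e1, e2, e3]
  exact (((((((BoundedEntireMatrix.suppCPow hNρ _ _).mul (.const W)).mul
    (.suppCPow hNσ _ _)).kronecker (.const 1)).mul (.const U)).mul (.suppCPow hσ _ _)).mul
    (.const V)).mul (.suppCPow hρ _ _)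

theorem schattenNorm_two_swiveledCPow (hρ : ρ.PosSemidef) (hσ : σ.PosSemidef)
    (hNρ : (N.apply ρ).PosSemidef) (hNσ : (N.apply σ).PosSemidef) (U : Matrix (K × E) H ℂ)
    (V : Matrix H H ℂ) (W : Matrix K K ℂ) (z : ℂ) :
    schattenNorm 2 (swiveledCPow hρ.isHermitian hσ.isHermitian hNρ.isHermitian
      hNσ.isHermitian U V W z) =
    swiveledNorm ρ σ N U z.re (imagPow hσ.isHermitian ((1 - z) / 2).im * V)
      (W * imagPow hNσ.isHermitian ((z - 1) / 2).im) := by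
  have e1 : ((1 - z) / 2).re = (1 - z.re) / 2 := by simp
  have e2 : ((z - 1) / 2).re = (z.re - 1) / 2 := by simp
  have e3 : (z / 2).re = z.re / 2 := by simp
  unfold swiveledNorm swiveledCPow
  -- The side of each phase is chosen so that those of σ and N(σ) touch V and W, and those of ρ and
  -- N(ρ) lie outermost.
  rw [suppCPow_eq_imagPow_mul hNρ, suppCPow_eq_imagPow_mul hNσ, suppCPow_eq_mul_imagPow hσ,
    suppCPow_eq_mul_imagPow hρ, e1, e2, e3]
  rw [← Matrix.mul_assoc _ (suppPow ρ _),
    schattenNorm_two_mul_unitary _ (imagPow_mem_unitaryGroup _ _)]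
  simp only [mul_kronecker_one, Matrix.mul_assoc]
  rw [schattenNorm_two_isometry_mul
    (kronecker_one_conjTranspose_mul_self (imagPow_mem_unitaryGroup _ _))]

/-- The bounds at l and u are uniform over swivels, so they hold along the whole boundary lines,
where only the swivels change. -/
theorem swiveledNorm_three_lines (hρ : ρ.PosSemidef) (hσ : σ.PosSemidef)
    (hU : IsIsometricExtension N U) {l u x : ℝ} (hlu : l < u) (hx : x ∈ Set.Icc l u) {a b : ℝ}
    (ha : ∀ V ∈ swivels σ, ∀ W ∈ swivels (N.apply σ), swiveledNorm ρ σ N U l V W ≤ a)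
    (hb : ∀ V ∈ swivels σ, ∀ W ∈ swivels (N.apply σ), swiveledNorm ρ σ N U u V W ≤ b)
    {V : Matrix H H ℂ} (hV : V ∈ swivels σ) {W : Matrix K K ℂ} (hW : W ∈ swivels (N.apply σ)) :
    swiveledNorm ρ σ N U x V W ≤ a ^ (1 - (x - l) / (u - l)) * b ^ ((x - l) / (u - l)) := by
  have hNρ := hU.apply_posSemidef hρ
  have hNσ := hU.apply_posSemidef hσ
  have hmem := fun z : ℂ => And.intro
    (imagPow_mul_mem_swivels hσ.isHermitian hV ((1 - z) / 2).im)
    (mul_imagPow_mem_swivels hNσ.isHermitian hW ((z - 1) / 2).im)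
  have key := schattenNorm_two_three_lines hlu
    (boundedEntireMatrix_swiveledCPow hρ hσ hNρ hNσ U V W l u) (a := a) (b := b)
    (fun z hz => by
      rw [schattenNorm_two_swiveledCPow hρ hσ hNρ hNσ, hz]
      exact ha _ (hmem z).1 _ (hmem z).2)
    (fun z hz => by
      rw [schattenNorm_two_swiveledCPow hρ hσ hNρ hNσ, hz]
      exact hb _ (hmem z).1 _ (hmem z).2)
    (z := (x : ℂ)) (by simpa using hx)
  have hval : swiveledCPow hρ.isHermitian hσ.isHermitian hNρ.isHermitian hNσ.isHermitian U V W x =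
      ((suppPow (N.apply ρ) ((1 - x) / 2) * W * suppPow (N.apply σ) ((x - 1) / 2)) ⊗ₖ
        (1 : Matrix E E ℂ)) * U * suppPow σ ((1 - x) / 2) * V * suppPow ρ (x / 2) := by
    simp only [← suppCPow_ofReal hρ, ← suppCPow_ofReal hσ, ← suppCPow_ofReal hNρ,
      ← suppCPow_ofReal hNσ, swiveledCPow]
    push_cast
    rfl
  rwa [hval] at key

end Channel

/-! ### From log-convexity to monotonicity -/

section LogConvex

theorem log_le_of_le_rpow {x y t : ℝ} (hx : 0 < x) (hy : 0 ≤ y) (ht : 0 < t) (h : x ≤ y ^ t) :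
    0 < y ∧ Real.log x ≤ t * Real.log y := by
  have hy' : 0 < y := by
    refine hy.lt_of_ne' fun h0 => ?_
    rw [h0, Real.zero_rpow ht.ne'] at h
    linarith
  refine ⟨hy', ?_⟩
  rw [← Real.log_rpow hy']
  exact Real.log_le_log hx h

/-- If `Z` is log-convex and at most one at `1`, then `2/(α-1) log Z(α)` is nondecreasing on either
side of `1`; if moreover `Z(1) = 1`, it is nondecreasing off `1`. -/
theorem monotoneOn_log_div {Z : ℝ → ℝ} {D : ℝ → EReal} (h0 : ∀ x, 0 ≤ Z x)
    (hconv : ∀ l x u, l < u → x ∈ Set.Icc l u →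
      Z x ≤ Z l ^ (1 - (x - l) / (u - l)) * Z u ^ ((x - l) / (u - l)))
    (h1 : Z 1 ≤ 1)
    (hD : ∀ x, D x = ((2 / (x - 1) : ℝ) : EReal) * ENNReal.log (ENNReal.ofReal (Z x))) :
    MonotoneOn D (Set.Iio 1) ∧ MonotoneOn D (Set.Ioi 1) ∧
      (Z 1 = 1 → MonotoneOn D {1}ᶜ) := by
  have hbot : ∀ x, 1 < x → Z x = 0 → D x = ⊥ := fun x hx hz => by
    rw [hD, hz, ENNReal.ofReal_zero, ENNReal.log_zero,
      EReal.coe_mul_bot_of_pos (div_pos two_pos (sub_pos.2 hx))]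
  have htop : ∀ x, x < 1 → Z x = 0 → D x = ⊤ := fun x hx hz => by
    rw [hD, hz, ENNReal.ofReal_zero, ENNReal.log_zero,
      EReal.coe_mul_bot_of_neg (div_neg_of_pos_of_neg two_pos (sub_neg.2 hx))]
  have hcoe : ∀ x, 0 < Z x → D x = ((2 / (x - 1) * Real.log (Z x) : ℝ) : EReal) := fun x hx => by
    rw [hD, ENNReal.log_ofReal_of_pos hx, EReal.coe_mul]
  have hlt : MonotoneOn D (Set.Iio 1) := by
    intro x hx y hy hxy
    simp only [Set.mem_Iio] at hx hy
    -- Below 1 the prefactor is negative, so a zero of Z gives the value +∞.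
    rcases (h0 y).eq_or_lt with hz | hz
    · rw [htop y hy hz.symm]
      exact le_top
    have hx' : 0 < 1 - x := by linarith
    have hy' : 0 < 1 - y := by linarith
    have h := hconv x y 1 hx ⟨hxy, hy.le⟩
    have he : 1 - (y - x) / (1 - x) = (1 - y) / (1 - x) := by field_simp; ring
    rw [he] at h
    -- The factor contributed by Z(1) ≤ 1 can be dropped, leaving Z(y) ≤ Z(x)^((1-y)/(1-x)).
    have h := log_le_of_le_rpow hz (h0 x) (div_pos hy' hx') (h.trans (mul_le_of_le_one_right
      (Real.rpow_nonneg (h0 x) _) (Real.rpow_le_one (h0 1) h1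
        (div_nonneg (by linarith) hx'.le))))
    rw [hcoe x h.1, hcoe y hz, EReal.coe_le_coe_iff]
    have h2 := h.2
    rw [div_mul_eq_mul_div, le_div_iff₀ hx'] at h2
    have ex : 2 / (x - 1) * Real.log (Z x) = -(2 * Real.log (Z x) / (1 - x)) := by
      rw [← neg_sub 1 x]; field_simp
    have ey : 2 / (y - 1) * Real.log (Z y) = -(2 * Real.log (Z y) / (1 - y)) := by
      rw [← neg_sub 1 y]; field_simp
    rw [ex, ey, neg_le_neg_iff, div_le_div_iff₀ hy' hx']
    linarith
  have hgt : MonotoneOn D (Set.Ioi 1) := by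
    intro x hx y hy hxy
    simp only [Set.mem_Ioi] at hx hy
    rcases (h0 x).eq_or_lt with hz | hz
    · rw [hbot x hx hz.symm]
      exact bot_le
    have hx' : 0 < x - 1 := by linarith
    have hy' : 0 < y - 1 := by linarith
    have h := hconv 1 x y hy ⟨hx.le, hxy⟩
    have h := log_le_of_le_rpow hz (h0 y) (div_pos hx' hy') (h.trans (mul_le_of_le_one_left
      (Real.rpow_nonneg (h0 y) _) (Real.rpow_le_one (h0 1) h1
        (sub_nonneg.2 ((div_le_one hy').2 (by linarith))))))
    rw [hcoe x hz, hcoe y h.1, EReal.coe_le_coe_iff, div_mul_eq_mul_div, div_mul_eq_mul_div,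
      div_le_div_iff₀ hx' hy']
    have h2 := h.2
    rw [div_mul_eq_mul_div, le_div_iff₀ hy'] at h2
    linarith
  refine ⟨hlt, hgt, fun hone x hx y hy hxy => ?_⟩
  rcases lt_or_gt_of_ne hx with hx | hx
  · rcases lt_or_gt_of_ne hy with hy | hy
    · exact hlt hx hy hxy
    · have hyx : 0 < y - x := by linarith
      -- Interpolating at 1 between x and y bounds Z(1) = 1 above, which forces Z(x), Z(y) > 0 and
      -- makes a weighted sum of their logarithms non-negative.
      have h := hconv x 1 y (by linarith) ⟨hx.le, hy.le⟩
      have he : 1 - (1 - x) / (y - x) = (y - 1) / (y - x) := by field_simp; ring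
      have hx' : 0 < 1 - x := by linarith
      have hy' : 0 < y - 1 := by linarith
      rw [he, hone] at h
      have hZx : 0 < Z x := by
        refine (h0 x).lt_of_ne' fun hz => ?_
        rw [hz, Real.zero_rpow (div_pos hy' hyx).ne', zero_mul] at h
        linarith
      have hZy : 0 < Z y := by
        refine (h0 y).lt_of_ne' fun hz => ?_
        rw [hz, Real.zero_rpow (div_pos hx' hyx).ne', mul_zero] at h
        linarith
      have h2 := Real.log_nonneg h
      rw [Real.log_mul (Real.rpow_pos_of_pos hZx _).ne' (Real.rpow_pos_of_pos hZy _).ne',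
        Real.log_rpow hZx, Real.log_rpow hZy, div_mul_eq_mul_div, div_mul_eq_mul_div,
        ← add_div] at h2
      have h3 := nonneg_of_mul_nonneg_left (div_eq_mul_inv _ (y - x) ▸ h2) (inv_pos.2 hyx)
      rw [hcoe x hZx, hcoe y hZy, EReal.coe_le_coe_iff]
      have ex : 2 / (x - 1) * Real.log (Z x) = (-(2 * Real.log (Z x))) / (1 - x) := by
        rw [← neg_sub 1 x]; field_simp
      rw [ex, div_mul_eq_mul_div, div_le_div_iff₀ hx' hy']
      linarith
  · exact hgt hx (lt_of_lt_of_le hx hxy) hxy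

end LogConvex

end SwiveledRenyi

end

/-! ### The monotonicity theorem -/

open SwiveledRenyi ComplexOrder in
theorem theorem2 {H K E : Type*} [Fintype H] [DecidableEq H] [Fintype K] [DecidableEq K]
    [Fintype E] [DecidableEq E] (ρ σ : Matrix H H ℂ) (N : QuantumChannel H K)
    (U : Matrix (K × E) H ℂ) (hρ : IsDensityOperator ρ) (hσ : σ.PosSemidef) (hσ0 : σ ≠ 0)
    (hU : IsIsometricExtension N U) :
    MonotoneOn (swiveledDiff ρ σ N U) (Set.Ico 0 1) ∧
    MonotoneOn (swiveledDiff ρ σ N U) (Set.Ioc 1 2) ∧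
    (supp ρ ≤ supp σ → MonotoneOn (swiveledDiff ρ σ N U) (Set.Ico 0 1 ∪ Set.Ioc 1 2)) := by
  choose V hV W hW hmax hD using fun α => exists_isMax_swiveledNorm ρ σ N U α
  obtain ⟨h1, h2, h3⟩ := monotoneOn_log_div (D := swiveledDiff ρ σ N U)
    (Z := fun α => swiveledNorm ρ σ N U α (V α) (W α)) (fun _ => schattenNorm_two_nonneg _)
    (fun l x u hlu hx => swiveledNorm_three_lines hρ.posSemidef hσ hU hlu hx (hmax l) (hmax u)
      (hV x) (hW x))
    (swiveledNorm_one_le hρ hσ hU (hV 1) (hW 1)) hD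
  refine ⟨h1.mono fun x hx => hx.2, h2.mono fun x hx => hx.1, fun hsupp => (h3 ?_).mono ?_⟩
  -- The trivial swivels already give norm 1, so the maximum at order 1 is exactly 1.
  · have h := hmax 1 1 (one_mem_swivels _) 1 (one_mem_swivels _)
    rw [swiveledNorm_one_one_one hρ hσ hU hsupp] at h
    exact le_antisymm (swiveledNorm_one_le hρ hσ hU (hV 1) (hW 1)) h
  · rintro x (hx | hx)
    · exact hx.2.ne
    · exact hx.1.ne'
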